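/- Let $\mathcal V$ be a symmetric monoidal closed category whose underlying ordinary category $\mathcal V_0$ is locally presentable. Fix a regular cardinal $\lambda_0$ such that $\mathcal V_0$ is locally $\lambda_0$-presentable, the unit object $I$ is $\lambda_0$-presentable, and the tensor product of two $\lambda_0$-presentable objects is $\lambda_0$-presentable (such a $\lambda_0$ always exists). Let $\mathcal G$ be a (small) strong generator of $\mathcal V_0$. For a $\mathcal V$-category $\mathcal C$ with underlying ordinary category $\mathcal C_0$, a conical colimit in $\mathcal C$ is a colimit in $\mathcal C_0$ that is preserved by $\mathcal C(-,Y)_0\colon \mathcal C_0\to\mathcal V_0^{\mathrm{op}}$ for every $Y\in\mathcal C$; $\lambda$-filtered colimits in $\mathcal C$ are conical colimits indexed by small $\lambda$-filtered categories. An object $X\in\mathcal C$ is $\lambda$-presentable if $\mathcal C(X,-)\colon\mathcal C\to\mathcal V$ preserves $\lambda$-filtered colimits. The $\mathcal V$-category $\mathcal C$ is $\lambda$-accessible if it admits $\lambda$-filtered colimits and there is a small set of $\lambda$-presentable objects such that every object of $\mathcal C$ is a $\lambda$-filtered colimit of objects in that set; it is accessible if it is $\lambda$-accessible for some regular cardinal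 $\lambda\ge\lambda_0$. A power of $X\in\mathcal C$ by $G\in\mathcal V$ is an object $G\pitchfork X$ with a morphism $G\to\mathcal C(G\pitchfork X,X)$ inducing isomorphisms $\mathcal C(B,G\pitchfork X)\cong[G,\mathcal C(B,X)]$ in $\mathcal V$ for all $B\in\mathcal C$. Let $\mathcal A$ and $\mathcal C$ be $\mathcal V$-categories with powers by the objects of $\mathcal G$, and let $U\colon\mathcal A\to\mathcal C$ be a $\mathcal V$-functor which preserves these powers and is conservative (that is, its underlying functor $U_0\colon\mathcal A_0\to\mathcal C_0$ reflects isomorphisms). Suppose that $\mathcal C$ is an accessible $\mathcal V$-category, that $\mathcal A_0$ is an accessible category, and that $U_0$ is an accessible functor (that is, it preserves $\lambda$-filtered colimits for some regular cardinal $\lambda$). Then $\mathcal A$ is an accessible $\mathcal V$-category. -/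

import Mathlib

universe w u u₁ u₂

namespace EnrichedAccessibility

open CategoryTheory Limits MonoidalCategory Opposite

section Base

variable (V : Type u) [Category.{w} V] [MonoidalCategory V]

/-- `κ` is a regular cardinal that is admissible as a lower bound for the cardinals used in the
`V`-enriched theory of accessibility: `V` is locally `κ`-presentable, the unit object is
`κ`-presentable, and the tensor product of two `κ`-presentable objects is `κ`-presentable. -/
structure IsBaseCardinal (κ : Cardinal.{w}) [Fact κ.IsRegular] : Prop where
  isCardinalLocallyPresentable : IsCardinalLocallyPresentable V κ
  isCardinalPresentable_unit : IsCardinalPresentable (𝟙_ V) κ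
  isCardinalPresentable_tensor (X Y : V) :
    IsCardinalPresentable X κ → IsCardinalPresentable Y κ → IsCardinalPresentable (X ⊗ Y) κ

/-- Base cardinals exist as soon as the symmetric monoidal closed category `V` is locally
presentable. -/
theorem exists_isBaseCardinal [SymmetricCategory V] [MonoidalClosed V]
    [IsLocallyPresentable.{w} V] :
    ∃ (κ : Cardinal.{w}) (_ : Fact κ.IsRegular), IsBaseCardinal V κ := by
  obtain ⟨κ₁, _, h₁⟩ := IsLocallyPresentable.exists_cardinal.{w} V
  obtain ⟨P, _, hP, hP'⟩ := (IsCardinalLocallyPresentable.iff_exists_isStrongGenerator V κ₁).1 h₁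
  have pres : ∀ X : V, ∃ (κ : Cardinal.{w}) (_ : Fact κ.IsRegular), IsCardinalPresentable X κ :=
    fun X => (inferInstance : IsPresentable.{w} X).exists_cardinal
  choose k hk hk' using pres
  let S := Shrink.{w} (Subtype P)
  let f : S → V := fun s => ((equivShrink _).symm s).1
  let g : (Option (S × S)) ⊕ Unit → Cardinal.{w} := Sum.elim (fun o => o.elim (k (𝟙_ V)) (fun p => k (f p.1 ⊗ f p.2))) (fun _ => κ₁)
  obtain ⟨κ, hκ, hlt⟩ := HasCardinalLT.exists_regular_cardinal_forall.{w} (fun i => (g i).ord.ToType)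
  have hle : ∀ i, g i ≤ κ := fun i => le_of_lt (by simpa [hasCardinalLT_iff_cardinal_mk_lt] using hlt i)
  have : Fact κ.IsRegular := ⟨hκ⟩
  have h1 : κ₁ ≤ κ := hle (.inr ())
  have hPκ : P ≤ isCardinalPresentable V κ := hP'.trans (isCardinalPresentable_monotone _ h1)
  have hcl := IsStrongGenerator.colimitsCardinalClosure_eq_isCardinalPresentable hP hPκ
  have : ∀ X : V, (tensorRight X).IsLeftAdjoint := fun X =>
    Functor.isLeftAdjoint_of_iso (BraidedCategory.tensorLeftIsoTensorRight X)
  have key : ∀ (F : V ⥤ V) [PreservesColimitsOfSize.{w,w} F], (∀ X, P X → IsCardinalPresentable (F.obj X) κ) →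
      ∀ X, IsCardinalPresentable X κ → IsCardinalPresentable (F.obj X) κ := by
    intro F _ hF X hX
    have : isCardinalPresentable V κ ≤ (isCardinalPresentable V κ).inverseImage F := by
      conv_lhs => rw [hcl]
      refine P.colimitsCardinalClosure_le κ (fun J _ hJ => ?_) hF
      have := isClosedUnderColimitsOfShape_isCardinalPresentable V (κ := κ) hJ
      infer_instance
    exact this X hX
  refine ⟨κ, ⟨hκ⟩, ⟨IsCardinalLocallyPresentable.of_le V h1, ?_, ?_⟩⟩
  · exact isCardinalPresentable_of_le (κ := k (𝟙_ V)) _ (hle (.inl none))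
  · intro X Y hX hY
    have step : ∀ X, P X → ∀ Y, IsCardinalPresentable Y κ → IsCardinalPresentable (X ⊗ Y) κ := by
      intro X hX
      refine key (tensorLeft X) (fun Y hY => ?_)
      have := hle (.inl (some (equivShrink _ ⟨X,hX⟩, equivShrink _ ⟨Y,hY⟩)))
      simp [g, f] at this
      exact isCardinalPresentable_of_le (κ := k (X ⊗ Y)) (X ⊗ Y) this
    have := key (tensorRight Y) (fun X hX => step X hX Y hY) X hX
    exact this

end Base

section ConicalColimits

variable (V : Type u) [Category.{w} V] [MonoidalCategory V]
variable {C : Type u₁} [EnrichedCategory V C]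

/-- The functor `C(-, Y)₀ : C₀ ⥤ V₀ᵒᵖ`, where `C₀ = ForgetEnrichment V C` is the underlying
category of the `V`-category `C`. -/
def homInto (Y : ForgetEnrichment V C) : ForgetEnrichment V C ⥤ Vᵒᵖ :=
  ((eHomFunctor V (ForgetEnrichment V C)).flip.obj Y).rightOp

/-- The functor `C(X, -)₀ : C₀ ⥤ V₀`. -/
def homFrom (X : ForgetEnrichment V C) : ForgetEnrichment V C ⥤ V :=
  (eHomFunctor V (ForgetEnrichment V C)).obj (op X)

/-- A cocone in `C₀` is a conical colimit in `C` if it is a colimit in `C₀` which is preserved by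
`C(-, Y)₀ : C₀ ⥤ V₀ᵒᵖ` for every object `Y`. -/
structure IsConicalColimit {J : Type w} [SmallCategory J] {F : J ⥤ ForgetEnrichment V C}
    (c : Cocone F) : Prop where
  isColimit : Nonempty (IsColimit c)
  isColimit_homInto (Y : ForgetEnrichment V C) : Nonempty (IsColimit ((homInto V Y).mapCocone c))

/-- An object `X` of a `V`-category `C` is `κ`-presentable if `C(X, -)` sends `κ`-filtered
(conical) colimits in `C` to colimits in `V`. -/
def IsEnrichedPresentable (X : ForgetEnrichment V C) (κ : Cardinal.{w}) [Fact κ.IsRegular] :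
    Prop :=
  ∀ (J : Type w) [SmallCategory J] [IsCardinalFiltered J κ] (F : J ⥤ ForgetEnrichment V C)
    (c : Cocone F), IsConicalColimit V c → Nonempty (IsColimit ((homFrom V X).mapCocone c))

variable (C)

/-- A `V`-category `C` is `κ`-accessible if it has `κ`-filtered (conical) colimits and a small set
`S` of `κ`-presentable objects such that every object is a `κ`-filtered (conical) colimit of
objects in `S`. -/
structure IsCardinalAccessibleVCategory (κ : Cardinal.{w}) [Fact κ.IsRegular] : Prop where
  exists_conicalColimit (J : Type w) [SmallCategory J] [IsCardinalFiltered J κ]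
    (F : J ⥤ ForgetEnrichment V C) : ∃ c : Cocone F, IsConicalColimit V c
  exists_generator : ∃ (S : ObjectProperty (ForgetEnrichment V C)),
    ObjectProperty.Small.{w} S ∧
    (∀ X, S X → IsEnrichedPresentable V X κ) ∧
    ∀ X : ForgetEnrichment V C, ∃ (J : Type w) (_ : SmallCategory J) (_ : IsCardinalFiltered J κ)
      (F : J ⥤ ForgetEnrichment V C) (c : Cocone F),
      (∀ j, S (F.obj j)) ∧ IsConicalColimit V c ∧ c.pt = X

/-- A `V`-category is accessible, relative to a base cardinal `κ₀`, if it is `κ`-accessible for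
some regular cardinal `κ ≥ κ₀`. -/
def IsAccessibleVCategory (κ₀ : Cardinal.{w}) : Prop :=
  ∃ (κ : Cardinal.{w}) (_ : Fact κ.IsRegular), κ₀ ≤ κ ∧ IsCardinalAccessibleVCategory V C κ

end ConicalColimits

section Powers

variable {V : Type u} [Category.{w} V] [MonoidalCategory V] [SymmetricCategory V]
  [MonoidalClosed V]
variable {C : Type u₁} [EnrichedCategory V C]

/-- Given `ε : G ⟶ C(P, X)`, the comparison morphism `C(B, P) ⟶ [G, C(B, X)]` in `V` which is
the transpose of `G ⊗ C(B, P) ≅ C(B, P) ⊗ G ⟶ C(B, P) ⊗ C(P, X) ⟶ C(B, X)`. -/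
def powerComparison {G : V} {P X : C} (ε : G ⟶ (EnrichedCategory.Hom P X : V)) (B : C) :
    (EnrichedCategory.Hom B P : V) ⟶ (ihom G).obj (EnrichedCategory.Hom B X) :=
  MonoidalClosed.curry
    ((β_ G (EnrichedCategory.Hom B P)).hom ≫ (EnrichedCategory.Hom B P) ◁ ε ≫ eComp V B P X)

/-- `ε : G ⟶ C(P, X)` exhibits `P` as the power `G ⋔ X` of `X` by `G` in the `V`-category `C`:
the (automatically `V`-natural) comparison `C(B, P) ⟶ [G, C(B, X)]` is invertible for all `B`. -/
def IsPower {G : V} {P X : C} (ε : G ⟶ (EnrichedCategory.Hom P X : V)) : Prop :=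
  ∀ B : C, IsIso (powerComparison ε B)

variable (C) in
/-- The `V`-category `C` has powers by all the objects in `𝒢`. -/
def HasPowersBy (𝒢 : ObjectProperty V) : Prop :=
  ∀ (G : V), 𝒢 G → ∀ X : C, ∃ (P : C) (ε : G ⟶ (EnrichedCategory.Hom P X : V)), IsPower ε

/-- The `V`-functor `U` preserves powers by the objects in `𝒢`. -/
def PreservesPowersBy {D : Type u₂} [EnrichedCategory V D] (U : EnrichedFunctor V C D)
    (𝒢 : ObjectProperty V) : Prop :=
  ∀ (G : V), 𝒢 G → ∀ (P X : C) (ε : G ⟶ (EnrichedCategory.Hom P X : V)),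
    IsPower ε → IsPower (ε ≫ U.map P X)

end Powers

end EnrichedAccessibility

/-!
Since `𝒢` is a strong generator of `V` and `V₀(G, A(X, -)) ≅ A₀(X, G ⋔ -)`, the functor
`A(X, -)` preserves `κ`-filtered colimits, for a `κ`-presentable object `X` of `A₀` and
`κ`-presentable objects `G ∈ 𝒢`, as soon as the power functors `G ⋔ - : A₀ ⥤ A₀` do. As `U` is
conservative, accessible and preserves these powers, it suffices that `G ⋔ U(-) : A₀ ⥤ C₀`
preserves `κ`-filtered colimits. This may be tested on a strong generator of `C₀` which consists
of objects `Z` that are presentable in the enriched sense, where it holds because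
`C₀(Z, G ⋔ U(-)) ≅ V₀(G, C(Z, U(-)))`. Moreover, colimits in `A₀` are automatically conical: the
functors `V₀(G, A(-, Y)) ≅ A₀(-, G ⋔ Y)` are representable.

All of this requires `A₀` to be `κ`-accessible for arbitrarily large `κ`. In order to raise the
index of accessibility of a category from `κ` to a sharply larger `κ'`, one covers a `κ`-directed
poset by its `κ`-directed subsets of cardinality `< κ'`: these subsets form a `κ'`-directed poset,
so that any `κ`-directed colimit becomes a `κ'`-directed colimit of `κ'`-small ones.
-/

namespace EnrichedAccessibility

open CategoryTheory Limits MonoidalCategory Opposite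

universe v v' u'

section RegularCardinals

/-- The relation "`κ` is sharply smaller than `κ'`", in the form of condition (iii) of
[Adámek–Rosický, 2.11]: the subsets of cardinality `< κ` of a set of cardinality `< κ'` have a
cofinal family of cardinality `< κ'`. -/
structure IsSharplySmaller (κ κ' : Cardinal.{w}) : Prop where
  lt : κ < κ'
  exists_isCofinal (X : Type w) (hX : HasCardinalLT X κ') :
    ∃ Y : Set (CardinalDirectedPoset.SetCardinalLT κ X), HasCardinalLT Y κ' ∧ IsCofinal Y

theorem exists_isSharplySmaller (κ μ : Cardinal.{w}) :
    ∃ (κ' : Cardinal.{w}) (_ : Fact κ'.IsRegular), μ ≤ κ' ∧ IsSharplySmaller κ κ' := by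
  let α := max Cardinal.aleph0 (max κ μ)
  have hα : Cardinal.aleph0 ≤ α := le_max_left _ _
  have hα' : Cardinal.aleph0 ≤ 2 ^ α := hα.trans (Cardinal.cantor α).le
  have hκα : κ ≤ α := (le_max_left _ _).trans (le_max_right _ _)
  have hμα : μ ≤ α := (le_max_right _ _).trans (le_max_right _ _)
  have hlt : α < Order.succ (2 ^ α) := (Cardinal.cantor α).trans (Order.lt_succ _)
  refine ⟨Order.succ (2 ^ α), ⟨Cardinal.isRegular_succ hα'⟩, hμα.trans hlt.le,
    hκα.trans_lt hlt, fun X hX => ⟨Set.univ, ?_, .univ⟩⟩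
  refine HasCardinalLT.of_injective ?_ _ Subtype.val_injective
  rw [hasCardinalLT_iff_cardinal_mk_lt, Order.lt_succ_iff] at hX ⊢
  calc Cardinal.mk (CardinalDirectedPoset.SetCardinalLT κ X)
      ≤ Cardinal.mk { t : Set X // Cardinal.mk t ≤ α } :=
        Cardinal.mk_subtype_mono fun t ht =>
          ((hasCardinalLT_iff_cardinal_mk_lt _ _).1 ht).le.trans hκα
    _ ≤ max (Cardinal.mk X) Cardinal.aleph0 ^ α := Cardinal.mk_bounded_set_le X α
    _ ≤ (2 ^ α) ^ α := Cardinal.power_le_power_right (max_le hX hα')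
    _ = 2 ^ α := by rw [← Cardinal.power_mul, Cardinal.mul_eq_self hα]

theorem hasCardinalLT_arrow_of_preorder {J : Type w} [Preorder J] {κ : Cardinal.{w}}
    (hκ : Cardinal.aleph0 ≤ κ) (hJ : HasCardinalLT J κ) : HasCardinalLT (Arrow J) κ :=
  (hasCardinalLT_prod hκ hJ hJ).of_injective (fun f => (f.left, f.right)) fun f g h => by
    obtain ⟨a, b, f⟩ := f
    obtain ⟨a', b', g⟩ := g
    obtain ⟨rfl, rfl⟩ : a = a' ∧ b = b' := Prod.mk.injEq .. ▸ h
    rw [Subsingleton.elim f g]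

theorem exists_le_isCardinalPresentable {D : Type u} [Category.{v} D] (P : ObjectProperty D)
    [ObjectProperty.Small.{w} P] (hP : ∀ X, P X → IsPresentable.{w} X) (μ : Cardinal.{w}) :
    ∃ (κ : Cardinal.{w}) (_ : Fact κ.IsRegular), μ ≤ κ ∧ P ≤ isCardinalPresentable D κ := by
  choose k hk hk' using fun X : Subtype P => (hP X.1 X.2).exists_cardinal
  let α := max Cardinal.aleph0 (max μ (⨆ X, k X))
  have hα : α ≤ Order.succ α := Order.le_succ α
  have : Fact (Order.succ α).IsRegular := ⟨Cardinal.isRegular_succ (le_max_left _ _)⟩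
  refine ⟨Order.succ α, this, ((le_max_left _ _).trans (le_max_right _ _)).trans hα,
    fun X hX => ?_⟩
  have hkα : k ⟨X, hX⟩ ≤ α :=
    (le_ciSup (Cardinal.bddAbove_of_small (s := Set.range k)) ⟨X, hX⟩).trans
      ((le_max_right _ _).trans (le_max_right _ _))
  have : IsCardinalPresentable X (k ⟨X, hX⟩) := hk' ⟨X, hX⟩
  exact isCardinalPresentable_of_le X (hkα.trans hα)

end RegularCardinals

section AccessibleFunctors

variable {D : Type u} [Category.{v} D] {K : Type u'} [Category.{v'} K]

theorem hasCardinalFilteredColimits_of_le {κ κ' : Cardinal.{w}} [Fact κ.IsRegular]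
    [Fact κ'.IsRegular] (h : κ ≤ κ') [HasCardinalFilteredColimits.{w} D κ] :
    HasCardinalFilteredColimits.{w} D κ' where
  hasColimitsOfShape J _ _ :=
    have := IsCardinalFiltered.of_le J h
    HasCardinalFilteredColimits.hasColimitsOfShape D κ J

theorem isCardinalAccessible_of_comp {E : Type u₁} [Category.{u₂} E] (κ : Cardinal.{w})
    [Fact κ.IsRegular] [HasCardinalFilteredColimits.{w} D κ] (T : K ⥤ D) (U : D ⥤ E)
    [U.ReflectsIsomorphisms] [U.IsCardinalAccessible κ] [(T ⋙ U).IsCardinalAccessible κ] :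
    T.IsCardinalAccessible κ where
  preservesColimitOfShape J _ _ := by
    have := HasCardinalFilteredColimits.hasColimitsOfShape D κ J
    have := U.preservesColimitsOfShape_of_isCardinalAccessible κ J
    have := (T ⋙ U).preservesColimitsOfShape_of_isCardinalAccessible κ J
    have := reflectsColimitsOfShape_of_reflectsIsomorphisms (J := J) (G := U)
    exact preservesColimitsOfShape_of_reflects_of_preserves T U

theorem isIso_of_isStrongGenerator {P : ObjectProperty D} (hP : P.IsStrongGenerator) {X Y : D}
    (f : X ⟶ Y) (hf : ∀ G, P G → Function.Bijective fun g : G ⟶ X => g ≫ f) : IsIso f := by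
  have : Mono f := ⟨fun g h e => hP.isSeparating _ _ fun G hG k =>
    (hf G hG).1 (by simp only [Category.assoc, e])⟩
  exact hP.isIso_of_mono f fun G hG => (hf G hG).2

theorem preservesColimitsOfShape_of_isStrongGenerator {P : ObjectProperty D}
    (hP : P.IsStrongGenerator) {J : Type w} [Category.{u₁} J] [HasColimitsOfShape J D] (T : K ⥤ D)
    (h₁ : ∀ G, P G → PreservesColimitsOfShape J (coyoneda.obj (op G)))
    (h₂ : ∀ G, P G → PreservesColimitsOfShape J (T ⋙ coyoneda.obj (op G))) :
    PreservesColimitsOfShape J T where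
  preservesColimit {F} := ⟨fun {c} hc => by
    let φ : colimit (F ⋙ T) ⟶ T.obj c.pt := colimit.desc (F ⋙ T) (T.mapCocone c)
    have : IsIso φ := isIso_of_isStrongGenerator hP φ fun G hG => by
      have := h₁ G hG
      have := h₂ G hG
      let hd := isColimitOfPreserves (coyoneda.obj (op G)) (colimit.isColimit (F ⋙ T))
      let hc' := isColimitOfPreserves (T ⋙ coyoneda.obj (op G)) hc
      let e := hd.coconePointUniqueUpToIso hc'
      have he : e.hom = (coyoneda.obj (op G)).map φ := hd.hom_ext fun j => by
        rw [hd.comp_coconePointUniqueUpToIso_hom]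
        refine Eq.trans ?_ ((coyoneda.obj (op G)).map_comp (colimit.ι (F ⋙ T) j) φ)
        rw [colimit.ι_desc]
        rfl
      have : IsIso ((coyoneda.obj (op G)).map φ) := he ▸ inferInstance
      exact (isIso_iff_bijective ((coyoneda.obj (op G)).map φ)).1 this
    exact ⟨IsColimit.ofIsoColimit (colimit.isColimit _)
      (Cocone.ext (asIso φ) fun j => colimit.ι_desc _ _)⟩⟩

theorem isCardinalAccessible_of_isStrongGenerator {P : ObjectProperty D}
    (hP : P.IsStrongGenerator) {κ : Cardinal.{w}} [Fact κ.IsRegular]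
    (hPκ : P ≤ isCardinalPresentable D κ) [HasCardinalFilteredColimits.{w} D κ] (T : K ⥤ D)
    (hT : ∀ G, P G → (T ⋙ coyoneda.obj (op G)).IsCardinalAccessible κ) :
    T.IsCardinalAccessible κ where
  preservesColimitOfShape J _ _ := by
    have := HasCardinalFilteredColimits.hasColimitsOfShape D κ J
    refine preservesColimitsOfShape_of_isStrongGenerator hP T (fun G hG => ?_) fun G hG => ?_
    · have : IsCardinalPresentable G κ := hPκ G hG
      exact preservesColimitsOfShape_of_isCardinalPresentable G κ J
    · have := hT G hG
      exact (T ⋙ coyoneda.obj (op G)).preservesColimitsOfShape_of_isCardinalAccessible κ J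

end AccessibleFunctors

section LimitsFromStrongGenerators

variable {D : Type u} [Category.{v} D]

theorem prop_of_isStrongGenerator_of_isClosedUnderColimitsOfShape [IsLocallyPresentable.{w} D]
    {P : ObjectProperty D} [ObjectProperty.Small.{w} P] (hP : P.IsStrongGenerator)
    (Q : ObjectProperty D) [Q.IsClosedUnderIsomorphisms]
    (hQ : ∀ (J : Type w) [SmallCategory J], Q.IsClosedUnderColimitsOfShape J) (hPQ : P ≤ Q)
    (X : D) : Q X := by
  obtain ⟨κ₁, _, _⟩ := IsLocallyPresentable.exists_cardinal.{w} D
  obtain ⟨κ, _, hκ, hPκ⟩ :=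
    exists_le_isCardinalPresentable.{w} P (fun _ _ => inferInstance) κ₁
  have := IsCardinalLocallyPresentable.of_le D hκ
  obtain ⟨J, _, _, hX⟩ :=
    (isCardinalFilteredGenerator_isCardinalPresentable D κ).exists_colimitsOfShape X
  refine (hQ J).colimitsOfShape_le _ (ObjectProperty.colimitsOfShape_monotone J ?_ X hX)
  rw [IsStrongGenerator.colimitsCardinalClosure_eq_isCardinalPresentable hP hPκ]
  exact P.colimitsCardinalClosure_le κ (fun J _ _ => hQ J) hPQ

variable {J : Type u'} [Category.{v'} J] {F : J ⥤ D}

/-- The objects `Z` for which the functor `D(Z, -)` sends the cone `c` to a limit cone, i.e. for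
which `c` has the universal property of a limit with respect to cones with vertex `Z`. -/
def isLimitCoyoneda (c : Cone F) : ObjectProperty D :=
  fun Z => Nonempty (IsLimit ((coyoneda.obj (op Z)).mapCone c))

theorem isLimitCoyoneda_iff (c : Cone F) (Z : D) :
    isLimitCoyoneda c Z ↔ ∀ π : (Functor.const J).obj Z ⟶ F,
      ∃! g : Z ⟶ c.pt, ∀ j, g ≫ c.π.app j = π.app j := by
  refine (Types.isLimit_iff _).trans ⟨fun h π => ?_, fun h s hs => ?_⟩
  · exact h (fun j => π.app j) fun f => (π.naturality f).symm.trans (Category.id_comp _)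
  · exact h ⟨s, fun j j' f => (Category.id_comp _).trans (hs f).symm⟩

instance (c : Cone F) : (isLimitCoyoneda c).IsClosedUnderIsomorphisms where
  of_iso e := fun ⟨h⟩ => ⟨IsLimit.mapConeEquiv (coyoneda.mapIso e.symm.op) h⟩

theorem isClosedUnderColimitsOfShape_isLimitCoyoneda (c : Cone F) (K : Type u₁)
    [Category.{u₂} K] : (isLimitCoyoneda c).IsClosedUnderColimitsOfShape K where
  colimitsOfShape_le := by
    rintro X ⟨p⟩
    refine (isLimitCoyoneda_iff c X).2 fun π => ?_
    choose g hg hg' using fun k =>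
      (isLimitCoyoneda_iff c _).1 (p.prop_diag_obj k) ((Functor.const J).map (p.ι.app k) ≫ π)
    have hw {k k' : K} (f : k ⟶ k') : p.diag.map f ≫ g k' = g k :=
      hg' k _ fun j => by
        rw [Category.assoc, hg k' j]
        simp
    let t : Cocone p.diag :=
      { pt := c.pt
        ι := { app := g, naturality := fun k k' f => by simp [hw] } }
    refine ⟨p.isColimit.desc t, fun j => p.isColimit.hom_ext fun k => ?_, fun g₁ hg₁ =>
      p.isColimit.hom_ext fun k => ?_⟩
    · rw [← Category.assoc, p.isColimit.fac]
      exact hg k j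
    · rw [p.isColimit.fac]
      refine hg' k _ fun j => ?_
      rw [Category.assoc, hg₁]
      rfl

theorem nonempty_isLimit_of_isStrongGenerator [IsLocallyPresentable.{w} D] {P : ObjectProperty D}
    [ObjectProperty.Small.{w} P] (hP : P.IsStrongGenerator) (c : Cone F)
    (hc : P ≤ isLimitCoyoneda c) : Nonempty (IsLimit c) :=
  ⟨coyonedaJointlyReflectsLimits F c fun Z =>
    (prop_of_isStrongGenerator_of_isClosedUnderColimitsOfShape.{w} hP (isLimitCoyoneda c)
      (fun K _ => isClosedUnderColimitsOfShape_isLimitCoyoneda c K) hc Z.unop).some⟩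

theorem preservesLimitsOfShape_of_isStrongGenerator [IsLocallyPresentable.{w} D]
    {P : ObjectProperty D} [ObjectProperty.Small.{w} P] (hP : P.IsStrongGenerator)
    {K : Type u₁} [Category.{u₂} K] (T : K ⥤ D)
    (hT : ∀ G, P G → PreservesLimitsOfShape J (T ⋙ coyoneda.obj (op G))) :
    PreservesLimitsOfShape J T where
  preservesLimit {_} := ⟨fun {c} hc =>
    nonempty_isLimit_of_isStrongGenerator hP (T.mapCone c) fun G hG =>
      have := hT G hG
      ⟨isLimitOfPreserves (T ⋙ coyoneda.obj (op G)) hc⟩⟩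

end LimitsFromStrongGenerators

section CoveringFamilies

variable {α : Type u₁} [Preorder α] {I : Type u₂} [Preorder I] (W : I →o Set α)

/-- A monotone family of subsets of `α`, as a functor to the category of categories. Its
Grothendieck construction is the preorder of the pairs `(i, a)` with `a ∈ W i`. -/
def coverToCat : I ⥤ Cat.{u₁, u₁} where
  obj i := Cat.of (W i)
  map f := Functor.toCatHom (Monotone.functor (f := Set.inclusion (W.monotone (leOfHom f)))
    fun _ _ h => h)

/-- The functor `(i, a) ↦ a` from the pairs with `a ∈ W i` to `α`. -/
def coverProj : Grothendieck (coverToCat W) ⥤ α where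
  obj x := x.fiber.1
  map f := homOfLE (leOfHom f.fiber)

variable {W} in
theorem nonempty_hom_coverToCat {i j : I} (hij : i ≤ j) {a b : α} (ha : a ∈ W i) (hb : b ∈ W j)
    (hab : a ≤ b) :
    Nonempty (Grothendieck.mk (F := coverToCat W) i (⟨a, ha⟩ : W i) ⟶
      Grothendieck.mk j (⟨b, hb⟩ : W j)) :=
  ⟨⟨homOfLE hij, homOfLE (X := W j) (x := ⟨a, W.monotone hij ha⟩) (y := ⟨b, hb⟩) hab⟩⟩

theorem final_coverProj [IsDirectedOrder I] (hW : ∀ a, ∃ i, a ∈ W i) : (coverProj W).Final where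
  out a := by
    let X (i : I) (h : a ∈ W i) : StructuredArrow a (coverProj W) :=
      StructuredArrow.mk (Y := .mk i (⟨a, h⟩ : W i)) (homOfLE le_rfl)
    obtain ⟨i₀, ha⟩ := hW a
    have : Nonempty (StructuredArrow a (coverProj W)) := ⟨X i₀ ha⟩
    have zigzag_X : ∀ Y : StructuredArrow a (coverProj W), Zigzag (X i₀ ha) Y
      | .mk (Y := ⟨i, ⟨b, hb⟩⟩) f => by
        obtain ⟨j, hj₀, hj⟩ := exists_ge_ge i₀ i
        have haj : a ∈ W j := W.monotone hj₀ ha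
        have hbj : b ∈ W j := W.monotone hj hb
        obtain ⟨g₁⟩ := nonempty_hom_coverToCat hj₀ ha haj le_rfl
        obtain ⟨g₂⟩ := nonempty_hom_coverToCat le_rfl haj hbj (leOfHom f)
        obtain ⟨g₃⟩ := nonempty_hom_coverToCat hj hb hbj le_rfl
        let Y' : StructuredArrow a (coverProj W) :=
          StructuredArrow.mk (Y := .mk j (⟨b, hbj⟩ : W j)) f
        exact (Zigzag.of_hom (j₂ := X j haj) (StructuredArrow.homMk g₁)).trans
          ((Zigzag.of_hom (j₂ := Y') (StructuredArrow.homMk g₂)).trans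
            (Zigzag.of_inv (StructuredArrow.homMk g₃)))
    exact zigzag_isConnected fun Y Y' => (zigzag_X Y).symm.trans (zigzag_X Y')

end CoveringFamilies

section RaisingTheIndex

variable {κ κ' : Cardinal.{w}} [Fact κ.IsRegular] [Fact κ'.IsRegular]

/-- The `κ`-directed subsets of cardinality `< κ'` of a preorder `α`. -/
abbrev DirectedSubset (α : Type w) [Preorder α] (κ κ' : Cardinal.{w}) [Fact κ.IsRegular] :
    Type w :=
  { B : Set α // IsCardinalFiltered B κ ∧ HasCardinalLT B κ' }

theorem exists_subset_directedSubset {α : Type w} [PartialOrder α] [IsCardinalFiltered α κ]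
    (h : IsSharplySmaller κ κ') {A : Set α} (hA : HasCardinalLT A κ') :
    ∃ B : DirectedSubset α κ κ', A ⊆ B.1 := by
  obtain ⟨B, hAB, hB⟩ := Cardinal.SharplyLT.exists_isCardinalFiltered_set_of_exists_cofinal
    h.lt h.exists_isCofinal A hA
  exact ⟨⟨B, hB⟩, hAB⟩

theorem isCardinalFiltered_directedSubset {α : Type w} [PartialOrder α] [IsCardinalFiltered α κ]
    (h : IsSharplySmaller κ κ') : IsCardinalFiltered (DirectedSubset α κ κ') κ' :=
  isCardinalFiltered_preorder _ _ fun K f hK => by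
    obtain ⟨B, hB⟩ := exists_subset_directedSubset h (A := ⋃ k, (f k).1)
      (hasCardinalLT_iUnion _ (by rwa [hasCardinalLT_iff_cardinal_mk_lt]) fun k => (f k).2.2)
    exact ⟨B, fun k => (Set.subset_iUnion (fun k => (f k).1) k).trans hB⟩

variable {D : Type u} [Category.{v} D]

theorem colimitsOfShape_directedSubset_colimitsCardinalClosure
    [HasCardinalFilteredColimits.{w} D κ] {P : ObjectProperty D}
    {α : Type w} [PartialOrder α] [IsCardinalFiltered α κ] (h : IsSharplySmaller κ κ') {X : D}
    (hX : P.colimitsOfShape α X) :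
    (P.colimitsCardinalClosure κ').colimitsOfShape (DirectedSubset α κ κ') X := by
  obtain ⟨p⟩ := hX
  let W : DirectedSubset α κ κ' →o Set α := ⟨Subtype.val, fun _ _ h => h⟩
  have aleph0_le : Cardinal.aleph0 ≤ κ' := Cardinal.IsRegular.aleph0_le Fact.out
  have := isCardinalFiltered_directedSubset (α := α) h
  have : IsDirectedOrder (DirectedSubset α κ κ') :=
    have := isFiltered_of_isCardinalFiltered (DirectedSubset α κ κ') κ'
    IsFiltered.isDirectedOrder _
  have : (coverProj W).Final := final_coverProj W fun a => by
    obtain ⟨B, hB⟩ :=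
      exists_subset_directedSubset h (hasCardinalLT_of_finite ({a} : Set α) _ aleph0_le)
    exact ⟨B, hB rfl⟩
  have (B : DirectedSubset α κ κ') : HasColimitsOfShape ((coverToCat W).obj B) D :=
    have : IsCardinalFiltered B.1 κ := B.2.1
    HasCardinalFilteredColimits.hasColimitsOfShape D κ B.1
  let hc := isColimitCoconeFiberwiseColimitOfCocone
    ((Functor.Final.isColimitWhiskerEquiv (coverProj W) _).symm p.isColimit)
  refine ⟨{ diag := _, ι := _, isColimit := hc, prop_diag_obj := fun B => ?_ }⟩
  have : (P.colimitsCardinalClosure κ').IsClosedUnderColimitsOfShape ((coverToCat W).obj B) :=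
    P.isClosedUnderColimitsOfShape_colimitsCardinalClosure κ' B.1
      (hasCardinalLT_arrow_of_preorder aleph0_le B.2.2)
  exact ObjectProperty.prop_colimit _ _ fun b =>
    P.le_colimitsCardinalClosure κ' _ (p.prop_diag_obj _)

theorem isCardinalFilteredGenerator_colimitsCardinalClosure [LocallySmall.{w} D]
    [HasCardinalFilteredColimits.{w} D κ] {P : ObjectProperty D}
    (hP : P.IsCardinalFilteredGenerator κ) (h : IsSharplySmaller κ κ') :
    (P.colimitsCardinalClosure.{w} κ').IsCardinalFilteredGenerator κ' := by
  have := hasCardinalFilteredColimits_of_le (D := D) h.lt.le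
  refine ⟨P.colimitsCardinalClosure_le_isCardinalPresentable
    (hP.le_isCardinalPresentable.trans (isCardinalPresentable_monotone _ h.lt.le)), fun X => ?_⟩
  obtain ⟨J, _, _, ⟨p⟩⟩ := hP.exists_colimitsOfShape X
  obtain ⟨α, _, _, R, _⟩ := IsCardinalFiltered.exists_cardinal_directed J κ
  exact ⟨DirectedSubset α κ κ', inferInstance, isCardinalFiltered_directedSubset h,
    colimitsOfShape_directedSubset_colimitsCardinalClosure h ⟨p.reindex R⟩⟩

theorem isCardinalAccessibleCategory_of_isSharplySmaller [IsCardinalAccessibleCategory D κ]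
    (h : IsSharplySmaller κ κ') : IsCardinalAccessibleCategory D κ' := by
  obtain ⟨P, _, hP⟩ := HasCardinalFilteredGenerator.exists_generator D κ
  have := hasCardinalFilteredColimits_of_le (D := D) h.lt.le
  have := (isCardinalFilteredGenerator_colimitsCardinalClosure hP h).hasCardinalFilteredGenerator
  constructor

theorem exists_isCardinalAccessibleCategory_ge (D : Type u) [Category.{v} D]
    [IsAccessibleCategory.{w} D] (μ : Cardinal.{w}) :
    ∃ (κ : Cardinal.{w}) (_ : Fact κ.IsRegular), μ ≤ κ ∧ IsCardinalAccessibleCategory D κ := by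
  obtain ⟨κ, _, _⟩ := IsAccessibleCategory.exists_cardinal.{w} D
  obtain ⟨κ', _, hμ, h⟩ := exists_isSharplySmaller κ μ
  exact ⟨κ', inferInstance, hμ, isCardinalAccessibleCategory_of_isSharplySmaller h⟩

end RaisingTheIndex

section UnderlyingHom

variable {V : Type u} [Category.{w} V] [MonoidalCategory V]
  {C : Type u₁} [Category.{w} C] [EnrichedOrdinaryCategory V C]

theorem eHomEquiv_comp_whiskerLeft {X Y Z : C} (f : X ⟶ Y) (g : Y ⟶ Z) :
    eHomEquiv V (f ≫ g) = eHomEquiv V f ≫ eHomWhiskerLeft V X g := by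
  rw [eHomEquiv_comp, eHomWhiskerLeft, rightUnitor_inv_naturality_assoc, tensorHom_def_assoc,
    unitors_inv_equal]

variable (V) in
/-- The isomorphism `C₀(X, -) ≅ V₀(𝟙_ V, C(X, -))`. -/
def coyonedaUnderlyingIso (X : C) :
    coyoneda.obj (op X) ≅ (eHomFunctor V C).obj (op X) ⋙ coyoneda.obj (op (𝟙_ V)) :=
  NatIso.ofComponents (fun _ => (eHomEquiv V).toIso) fun g => by
    ext f
    exact eHomEquiv_comp_whiskerLeft (V := V) f g

variable (V) in
theorem isCardinalPresentable_of_isCardinalAccessible_eHomFunctor_obj (X : C) (κ : Cardinal.{w})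
    [Fact κ.IsRegular] [IsCardinalPresentable (𝟙_ V) κ]
    [((eHomFunctor V C).obj (op X)).IsCardinalAccessible κ] : IsCardinalPresentable X κ :=
  Functor.isCardinalAccessible_of_natIso (coyonedaUnderlyingIso V X).symm κ

end UnderlyingHom

section Powers

variable {V : Type u} [Category.{w} V] [MonoidalCategory V] [SymmetricCategory V]
  [MonoidalClosed V] {C : Type u₁} [Category.{w} C] [EnrichedOrdinaryCategory V C]

/-- The universal property of a power in the underlying category: morphisms into `P = G ⋔ X`
correspond to morphisms out of `G`. -/
noncomputable def IsPower.homEquiv {G : V} {P X : C} {ε : G ⟶ (P ⟶[V] X)} (hε : IsPower ε)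
    (B : C) : (B ⟶ P) ≃ (G ⟶ (B ⟶[V] X)) :=
  have := hε B
  (eHomEquiv V).trans ((asIso (powerComparison ε B)).homToEquiv.trans
    (((ihom.adjunction G).homEquiv _ _).symm.trans (ρ_ G).homFromEquiv))

theorem IsPower.homEquiv_apply {G : V} {P X : C} {ε : G ⟶ (P ⟶[V] X)} (hε : IsPower ε)
    {B : C} (f : B ⟶ P) : hε.homEquiv B f = ε ≫ eHomWhiskerRight V f X := by
  have := hε B
  calc hε.homEquiv B f
      = (ρ_ G).inv ≫ MonoidalClosed.uncurry (eHomEquiv V f ≫ powerComparison ε B) := rfl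
    _ = ε ≫ eHomWhiskerRight V f X := by
      rw [MonoidalClosed.uncurry_natural_left, powerComparison, MonoidalClosed.uncurry_curry,
        eHomWhiskerRight, BraidedCategory.braiding_naturality_right_assoc,
        ← whisker_exchange_assoc, braiding_tensorUnit_right]
      simp

theorem IsPower.homEquiv_comp {G : V} {P X : C} {ε : G ⟶ (P ⟶[V] X)} (hε : IsPower ε)
    {B B' : C} (f : B' ⟶ B) (g : B ⟶ P) :
    hε.homEquiv B' (f ≫ g) = hε.homEquiv B g ≫ eHomWhiskerRight V f X := by
  simp only [hε.homEquiv_apply, eHomWhiskerRight_comp, Category.assoc]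

/-- The isomorphism `C₀(-, G ⋔ X) ≅ V₀(G, C(-, X))`. -/
noncomputable def IsPower.yonedaIso {G : V} {P X : C} {ε : G ⟶ (P ⟶[V] X)} (hε : IsPower ε) :
    yoneda.obj P ≅ (eHomFunctor V C).flip.obj X ⋙ coyoneda.obj (op G) :=
  NatIso.ofComponents (fun B => (hε.homEquiv B.unop).toIso) fun f => by
    ext g
    exact hε.homEquiv_comp f.unop g

theorem preservesLimitsOfShape_eHomFunctor_flip [IsLocallyPresentable.{w} V] {𝒢 : ObjectProperty V}
    [ObjectProperty.Small.{w} 𝒢] (h𝒢 : 𝒢.IsStrongGenerator) (hC : HasPowersBy C 𝒢) (Y : C)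
    (J : Type u') [Category.{v'} J] :
    PreservesLimitsOfShape J ((eHomFunctor V C).flip.obj Y) :=
  preservesLimitsOfShape_of_isStrongGenerator h𝒢 _ fun G hG => by
    obtain ⟨P, ε, hε⟩ := hC G hG Y
    exact preservesLimitsOfShape_of_natIso hε.yonedaIso

section FunctorPowers

variable {K : Type u₂} [Category.{v} K]

/-- The data which exhibits the functor `T' : K ⥤ C` as the pointwise power by `G` of the functor
`T : K ⥤ C`. -/
structure FunctorPower (G : V) (T' T : K ⥤ C) where
  /-- the counit of the power -/
  ε (k : K) : G ⟶ (T'.obj k ⟶[V] T.obj k)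
  isPower (k : K) : IsPower (ε k)
  naturality {k l : K} (f : k ⟶ l) :
    ε k ≫ eHomWhiskerLeft V (T'.obj k) (T.map f) = ε l ≫ eHomWhiskerRight V (T'.map f) (T.obj l)

/-- The isomorphism `C₀(X, G ⋔ T(-)) ≅ V₀(G, C(X, T(-)))`. -/
noncomputable def FunctorPower.coyonedaIso {G : V} {T' T : K ⥤ C} (h : FunctorPower G T' T)
    (X : C) :
    T' ⋙ coyoneda.obj (op X) ≅ (T ⋙ (eHomFunctor V C).obj (op X)) ⋙ coyoneda.obj (op G) :=
  NatIso.ofComponents (fun k => ((h.isPower k).homEquiv X).toIso) fun {k l} f => by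
    ext x
    calc (h.isPower l).homEquiv X (x ≫ T'.map f)
        = (h.ε l ≫ eHomWhiskerRight V (T'.map f) (T.obj l)) ≫ eHomWhiskerRight V x (T.obj l) := by
          rw [IsPower.homEquiv_comp, IsPower.homEquiv_apply]
      _ = (h.ε k ≫ eHomWhiskerRight V x (T.obj k)) ≫ eHomWhiskerLeft V X (T.map f) := by
          rw [← h.naturality, Category.assoc, Category.assoc, eHom_whisker_exchange]
      _ = (h.isPower k).homEquiv X x ≫ eHomWhiskerLeft V X (T.map f) := by
          rw [IsPower.homEquiv_apply]

theorem exists_functorPower {G : V} (T : K ⥤ C)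
    (hT : ∀ k, ∃ (P : C) (ε : G ⟶ (P ⟶[V] T.obj k)), IsPower ε) :
    ∃ T' : K ⥤ C, Nonempty (FunctorPower G T' T) := by
  choose P ε hε using hT
  let m {k l : K} (f : k ⟶ l) : P k ⟶ P l :=
    ((hε l).homEquiv (P k)).symm (ε k ≫ eHomWhiskerLeft V (P k) (T.map f))
  have hm {k l : K} (f : k ⟶ l) :
      ε l ≫ eHomWhiskerRight V (m f) (T.obj l) = ε k ≫ eHomWhiskerLeft V (P k) (T.map f) := by
    rw [← (hε l).homEquiv_apply, Equiv.apply_symm_apply]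
  let T' : K ⥤ C :=
    { obj := P
      map := m
      map_id := fun k => ((hε k).homEquiv (P k)).injective <| by
        rw [IsPower.homEquiv_apply, IsPower.homEquiv_apply, hm, T.map_id, eHomWhiskerLeft_id,
          eHomWhiskerRight_id]
      map_comp := fun {k l n} f g => ((hε n).homEquiv (P k)).injective <| by
        rw [IsPower.homEquiv_comp, IsPower.homEquiv_apply, IsPower.homEquiv_apply, hm, hm,
          Category.assoc, eHom_whisker_exchange, reassoc_of% hm f, Functor.map_comp,
          eHomWhiskerLeft_comp] }
  exact ⟨T', ⟨{ ε := ε, isPower := hε, naturality := fun f => (hm f).symm }⟩⟩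

theorem FunctorPower.isCardinalAccessible {κ : Cardinal.{w}} [Fact κ.IsRegular]
    [HasCardinalFilteredColimits.{w} C κ] [IsCardinalPresentable (𝟙_ V) κ] {G : V}
    [IsCardinalPresentable G κ] {S : ObjectProperty C} (hS : S.IsStrongGenerator)
    (hSκ : ∀ X, S X → ((eHomFunctor V C).obj (op X)).IsCardinalAccessible κ)
    {T' T : K ⥤ C} [T.IsCardinalAccessible κ] (h : FunctorPower G T' T) :
    T'.IsCardinalAccessible κ := by
  refine isCardinalAccessible_of_isStrongGenerator hS (fun X hX => ?_) T' fun X hX => ?_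
  · have := hSκ X hX
    exact isCardinalPresentable_of_isCardinalAccessible_eHomFunctor_obj V X κ
  · have := hSκ X hX
    exact Functor.isCardinalAccessible_of_natIso (h.coyonedaIso X).symm κ

theorem isCardinalAccessible_eHomFunctor_obj {κ : Cardinal.{w}} [Fact κ.IsRegular]
    [HasCardinalFilteredColimits.{w} V κ] {𝒢 : ObjectProperty V} (h𝒢 : 𝒢.IsStrongGenerator)
    (h𝒢κ : 𝒢 ≤ isCardinalPresentable V κ)
    (hC : ∀ G, 𝒢 G → ∃ T : C ⥤ C, T.IsCardinalAccessible κ ∧ Nonempty (FunctorPower G T (𝟭 C)))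
    (X : C) [IsCardinalPresentable X κ] :
    ((eHomFunctor V C).obj (op X)).IsCardinalAccessible κ :=
  isCardinalAccessible_of_isStrongGenerator h𝒢 h𝒢κ _ fun G hG => by
    obtain ⟨T, _, ⟨hT⟩⟩ := hC G hG
    exact Functor.isCardinalAccessible_of_natIso (hT.coyonedaIso X) κ

end FunctorPowers

end Powers

section UnderlyingFunctor

variable {V : Type u} [Category.{w} V] [MonoidalCategory V]
  {A : Type u₁} [EnrichedCategory V A] {C : Type u₂} [EnrichedCategory V C]

theorem eHomWhiskerLeft_map (U : EnrichedFunctor V A C) (X : ForgetEnrichment V A)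
    {Y Y' : ForgetEnrichment V A} (g : Y ⟶ Y') :
    eHomWhiskerLeft V X g ≫ U.map X Y' =
      U.map X Y ≫ eHomWhiskerLeft V (U.forget.obj X) (U.forget.map g) := by
  have (X Y Y' : A) (g : 𝟙_ V ⟶ (Y ⟶[V] Y')) :
      ((ρ_ _).inv ≫ _ ◁ g ≫ eComp V X Y Y') ≫ U.map X Y' =
        U.map X Y ≫ (ρ_ _).inv ≫ _ ◁ (g ≫ U.map Y Y') ≫
          eComp V (U.obj X) (U.obj Y) (U.obj Y') := by
    rw [Category.assoc, Category.assoc, U.map_comp, tensorHom_def'_assoc,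
      rightUnitor_inv_naturality_assoc, ← whisker_exchange_assoc,
      MonoidalCategory.whiskerLeft_comp_assoc]
  exact this X Y Y' g

theorem eHomWhiskerRight_map (U : EnrichedFunctor V A C) {X X' : ForgetEnrichment V A}
    (f : X ⟶ X') (Y : ForgetEnrichment V A) :
    eHomWhiskerRight V f Y ≫ U.map X Y =
      U.map X' Y ≫ eHomWhiskerRight V (U.forget.map f) (U.forget.obj Y) := by
  have (X X' Y : A) (f : 𝟙_ V ⟶ (X ⟶[V] X')) :
      ((λ_ _).inv ≫ f ▷ _ ≫ eComp V X X' Y) ≫ U.map X Y =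
        U.map X' Y ≫ (λ_ _).inv ≫ (f ≫ U.map X X') ▷ _ ≫
          eComp V (U.obj X) (U.obj X') (U.obj Y) := by
    rw [Category.assoc, Category.assoc, U.map_comp, tensorHom_def_assoc,
      leftUnitor_inv_naturality_assoc, whisker_exchange_assoc, comp_whiskerRight_assoc]
  exact this X X' Y f

end UnderlyingFunctor

section PowersInVCategories

variable {V : Type u} [Category.{w} V] [MonoidalCategory V] [SymmetricCategory V]
  [MonoidalClosed V] {A : Type u₁} [EnrichedCategory V A] {C : Type u₂} [EnrichedCategory V C]

/-- The image of a pointwise power of `T : K ⥤ A₀` by `G` under a `V`-functor which preserves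
powers by `G`. -/
def FunctorPower.map {G : V} {K : Type u'} [Category.{v'} K] {T' T : K ⥤ ForgetEnrichment V A}
    (h : FunctorPower G T' T) {U : EnrichedFunctor V A C} {𝒢 : ObjectProperty V}
    (hU : PreservesPowersBy U 𝒢) (hG : 𝒢 G) :
    FunctorPower G (T' ⋙ U.forget) (T ⋙ U.forget) where
  ε k := h.ε k ≫ U.map (T'.obj k) (T.obj k)
  isPower k := hU G hG _ _ _ (h.isPower k)
  naturality {k l} f := by
    have hf := h.naturality f =≫ U.map (T'.obj k) (T.obj l)
    have h₁ := h.ε k ≫= eHomWhiskerLeft_map U (T'.obj k) (T.map f)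
    have h₂ := h.ε l ≫= eHomWhiskerRight_map U (T'.map f) (T.obj l)
    refine (Category.assoc _ _ _).trans (h₁.symm.trans ?_)
    refine Eq.trans ?_ (h₂.trans (Category.assoc _ _ _).symm)
    exact (Category.assoc _ _ _).symm.trans (hf.trans (Category.assoc _ _ _))

theorem isConicalColimit_of_isColimit [IsLocallyPresentable.{w} V] {𝒢 : ObjectProperty V}
    [ObjectProperty.Small.{w} 𝒢] (h𝒢 : 𝒢.IsStrongGenerator) (hC : HasPowersBy C 𝒢)
    {J : Type w} [SmallCategory J] {F : J ⥤ ForgetEnrichment V C} {c : Cocone F}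
    (hc : IsColimit c) : IsConicalColimit V c where
  isColimit := ⟨hc⟩
  isColimit_homInto Y := by
    have := preservesLimitsOfShape_eHomFunctor_flip (C := ForgetEnrichment V C) h𝒢 hC Y Jᵒᵖ
    have : PreservesColimitsOfShape J (homInto V Y) :=
      preservesColimitsOfShape_rightOp J ((eHomFunctor V (ForgetEnrichment V C)).flip.obj Y)
    exact ⟨isColimitOfPreserves (homInto V Y) hc⟩

end PowersInVCategories

section AccessibleVCategories

variable {V : Type u} [Category.{w} V] [MonoidalCategory V] {C : Type u₁} [EnrichedCategory V C]

theorem IsConicalColimit.of_isColimit {J : Type w} [SmallCategory J]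
    {F : J ⥤ ForgetEnrichment V C} {c c' : Cocone F} (hc : IsConicalColimit V c)
    (hc' : IsColimit c') : IsConicalColimit V c' where
  isColimit := ⟨hc'⟩
  isColimit_homInto Y := by
    obtain ⟨h⟩ := hc.isColimit
    obtain ⟨hY⟩ := hc.isColimit_homInto Y
    exact ⟨hY.ofIsoColimit ((Cocone.functoriality F (homInto V Y)).mapIso (h.uniqueUpToIso hc'))⟩

theorem IsCardinalAccessibleVCategory.hasCardinalFilteredColimits {κ : Cardinal.{w}}
    [Fact κ.IsRegular] (hC : IsCardinalAccessibleVCategory V C κ) :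
    HasCardinalFilteredColimits.{w} (ForgetEnrichment V C) κ where
  hasColimitsOfShape J _ _ :=
    ⟨fun F => by
      obtain ⟨c, hc⟩ := hC.exists_conicalColimit J F
      exact ⟨⟨c, hc.isColimit.some⟩⟩⟩

theorem IsEnrichedPresentable.isCardinalAccessible_homFrom {κ : Cardinal.{w}} [Fact κ.IsRegular]
    (hC : IsCardinalAccessibleVCategory V C κ) {X : ForgetEnrichment V C}
    (hX : IsEnrichedPresentable V X κ) : (homFrom V X).IsCardinalAccessible κ where
  preservesColimitOfShape J _ _ :=
    ⟨fun {F} => ⟨fun {c} hc => by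
      obtain ⟨_, hc'⟩ := hC.exists_conicalColimit J F
      exact hX J F c (hc'.of_isColimit hc)⟩⟩

theorem IsCardinalAccessibleVCategory.exists_isStrongGenerator {κ : Cardinal.{w}}
    [Fact κ.IsRegular] (hC : IsCardinalAccessibleVCategory V C κ) :
    ∃ S : ObjectProperty (ForgetEnrichment V C), S.IsStrongGenerator ∧
      ∀ X, S X → (homFrom V X).IsCardinalAccessible κ := by
  obtain ⟨S, -, hSκ, hS⟩ := hC.exists_generator
  refine ⟨S, .mk_of_exists_colimitsOfShape.{w} fun X => ?_, fun X hX =>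
    (hSκ X hX).isCardinalAccessible_homFrom hC⟩
  obtain ⟨J, _, _, F, c, hF, hc, rfl⟩ := hS X
  obtain ⟨hc⟩ := hc.isColimit
  exact ⟨J, inferInstance, ⟨{ diag := F, ι := c.ι, isColimit := hc, prop_diag_obj := hF }⟩⟩

theorem isCardinalAccessibleVCategory_of_isCardinalAccessibleCategory {κ : Cardinal.{w}}
    [Fact κ.IsRegular] [IsCardinalAccessibleCategory (ForgetEnrichment V C) κ]
    (hconical : ∀ (J : Type w) [SmallCategory J] (F : J ⥤ ForgetEnrichment V C) (c : Cocone F),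
      IsColimit c → IsConicalColimit V c)
    (hpres : ∀ (X : ForgetEnrichment V C) [IsCardinalPresentable X κ],
      (homFrom V X).IsCardinalAccessible κ) :
    IsCardinalAccessibleVCategory V C κ where
  exists_conicalColimit J _ _ F := by
    have := HasCardinalFilteredColimits.hasColimitsOfShape (ForgetEnrichment V C) κ J
    exact ⟨_, hconical J F _ (colimit.isColimit F)⟩
  exists_generator := by
    obtain ⟨S, _, hS⟩ :=
      HasCardinalFilteredGenerator.exists_small_generator.{w} (ForgetEnrichment V C) κ
    refine ⟨S, inferInstance, fun X hX J _ _ F c hc => ?_, fun X => ?_⟩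
    · obtain ⟨hc⟩ := hc.isColimit
      have : IsCardinalPresentable X κ := hS.le_isCardinalPresentable _ hX
      have := hpres X
      have := (homFrom V X).preservesColimitsOfShape_of_isCardinalAccessible κ J
      exact ⟨isColimitOfPreserves (homFrom V X) hc⟩
    · obtain ⟨J, _, _, ⟨p⟩⟩ := hS.exists_colimitsOfShape X
      exact ⟨J, inferInstance, inferInstance, p.diag, p.cocone, p.prop_diag_obj,
        hconical J _ _ p.isColimit, rfl⟩

end AccessibleVCategories

section ConservativeFunctors

variable {V : Type u} [Category.{w} V] [MonoidalCategory V] [SymmetricCategory V]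
  [MonoidalClosed V] {A : Type u₁} [EnrichedCategory V A] {C : Type u₂} [EnrichedCategory V C]

theorem FunctorPower.isCardinalAccessible_of_reflectsIsomorphisms {κ κ' : Cardinal.{w}}
    [Fact κ.IsRegular] [Fact κ'.IsRegular] (hκ : κ ≤ κ') [IsCardinalPresentable (𝟙_ V) κ'] {G : V}
    [IsCardinalPresentable G κ'] (hC : IsCardinalAccessibleVCategory V C κ)
    [HasCardinalFilteredColimits.{w} (ForgetEnrichment V A) κ']
    {U : EnrichedFunctor V A C} [U.forget.ReflectsIsomorphisms] [U.forget.IsCardinalAccessible κ']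
    {𝒢 : ObjectProperty V} (hU : PreservesPowersBy U 𝒢) (hG : 𝒢 G)
    {T : ForgetEnrichment V A ⥤ ForgetEnrichment V A}
    (hT : FunctorPower G T (𝟭 _)) : T.IsCardinalAccessible κ' := by
  obtain ⟨S, hS, hSκ⟩ := hC.exists_isStrongGenerator
  have := hC.hasCardinalFilteredColimits
  have := hasCardinalFilteredColimits_of_le (D := ForgetEnrichment V C) hκ
  have : (T ⋙ U.forget).IsCardinalAccessible κ' :=
    FunctorPower.isCardinalAccessible hS (fun X hX =>
      have := hSκ X hX
      Functor.isCardinalAccessible_of_le (homFrom V X) hκ) (hT.map hU hG)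
  exact isCardinalAccessible_of_comp κ' T U.forget

theorem isCardinalAccessibleVCategory_of_reflectsIsomorphisms [IsLocallyPresentable.{w} V]
    {𝒢 : ObjectProperty V} [ObjectProperty.Small.{w} 𝒢] (h𝒢 : 𝒢.IsStrongGenerator)
    (hA : HasPowersBy A 𝒢) {U : EnrichedFunctor V A C} (hU : PreservesPowersBy U 𝒢)
    [U.forget.ReflectsIsomorphisms] {κ κ' : Cardinal.{w}} [Fact κ.IsRegular] [Fact κ'.IsRegular]
    (hκ : κ ≤ κ') [IsCardinalPresentable (𝟙_ V) κ'] (h𝒢κ : 𝒢 ≤ isCardinalPresentable V κ')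
    (hC : IsCardinalAccessibleVCategory V C κ)
    [IsCardinalAccessibleCategory (ForgetEnrichment V A) κ'] [U.forget.IsCardinalAccessible κ'] :
    IsCardinalAccessibleVCategory V A κ' := by
  obtain ⟨_, _, _⟩ := IsLocallyPresentable.exists_cardinal.{w} V
  refine isCardinalAccessibleVCategory_of_isCardinalAccessibleCategory
    (fun J _ F c hc => isConicalColimit_of_isColimit h𝒢 hA hc) fun X _ =>
    isCardinalAccessible_eHomFunctor_obj h𝒢 h𝒢κ (fun G hG => ?_) X
  have : IsCardinalPresentable G κ' := h𝒢κ G hG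
  obtain ⟨T, ⟨hT⟩⟩ := exists_functorPower (𝟭 (ForgetEnrichment V A)) (hA G hG)
  exact ⟨T, hT.isCardinalAccessible_of_reflectsIsomorphisms hκ hC hU hG, ⟨hT⟩⟩

end ConservativeFunctors

end EnrichedAccessibility

open CategoryTheory MonoidalCategory EnrichedAccessibility in
theorem mainTheorem7_general
    {V : Type u} [Category.{w} V] [MonoidalCategory V] [SymmetricCategory V] [MonoidalClosed V]
    [IsLocallyPresentable.{w} V]
    {𝒢 : ObjectProperty V} [ObjectProperty.Small.{w} 𝒢] (h𝒢 : 𝒢.IsStrongGenerator)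
    {A : Type u₁} [EnrichedCategory V A] {C : Type u₂} [EnrichedCategory V C]
    (hA : HasPowersBy A 𝒢) {U : EnrichedFunctor V A C} (hU : PreservesPowersBy U 𝒢)
    (hUcons : U.forget.ReflectsIsomorphisms)
    {κ₀ : Cardinal.{w}} (hCacc : IsAccessibleVCategory V C κ₀)
    (hAacc : IsAccessibleCategory.{w} (ForgetEnrichment V A))
    (hUacc : U.forget.IsAccessible.{w}) :
    IsAccessibleVCategory V A κ₀ := by
  obtain ⟨κ, _, hκ₀, hC⟩ := hCacc
  obtain ⟨ν, _, _⟩ := hUacc.exists_cardinal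
  obtain ⟨μ, _, hμ, h𝒢μ⟩ := exists_le_isCardinalPresentable
    (𝒢 ⊔ .singleton (𝟙_ V)) (fun _ _ => inferInstance) (max κ ν)
  obtain ⟨κ', _, hκ', _⟩ := exists_isCardinalAccessibleCategory_ge (ForgetEnrichment V A) μ
  obtain ⟨hκ, hν⟩ : κ ≤ κ' ∧ ν ≤ κ' := max_le_iff.1 (hμ.trans hκ')
  obtain ⟨h𝒢κ', hunit⟩ := sup_le_iff.1 (h𝒢μ.trans (isCardinalPresentable_monotone V hκ'))
  have := Functor.isCardinalAccessible_of_le U.forget hν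
  have : IsCardinalPresentable (𝟙_ V) κ' := ObjectProperty.singleton_le_iff.1 hunit
  exact ⟨κ', inferInstance, hκ₀.trans hκ,
    isCardinalAccessibleVCategory_of_reflectsIsomorphisms h𝒢 hA hU hκ h𝒢κ' hC⟩

open CategoryTheory EnrichedAccessibility in
theorem mainTheorem7
    {V : Type u} [Category.{w} V] [MonoidalCategory V] [SymmetricCategory V] [MonoidalClosed V]
    (κ₀ : Cardinal.{w}) [Fact κ₀.IsRegular] (hκ₀ : IsBaseCardinal V κ₀)
    (𝒢 : ObjectProperty V) [ObjectProperty.Small.{w} 𝒢] (h𝒢 : 𝒢.IsStrongGenerator)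
    {A : Type u₁} [EnrichedCategory V A] {C : Type u₂} [EnrichedCategory V C]
    (hA : HasPowersBy A 𝒢) (hC : HasPowersBy C 𝒢)
    (U : EnrichedFunctor V A C) (hU : PreservesPowersBy U 𝒢)
    (hUcons : U.forget.ReflectsIsomorphisms)
    (hCacc : IsAccessibleVCategory V C κ₀)
    (hAacc : IsAccessibleCategory.{w} (ForgetEnrichment V A))
    (hUacc : U.forget.IsAccessible.{w}) :
    IsAccessibleVCategory V A κ₀ := by
  have := hκ₀.isCardinalLocallyPresentable
  have : IsLocallyPresentable.{w} V := ⟨κ₀, inferInstance, this⟩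
  exact mainTheorem7_general h𝒢 hA hU hUcons hCacc hAacc hUacc
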